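/- All graphs are finite, simple, undirected and unweighted. For a connected graph $G$ with at least two vertices and Laplacian $L=D-A$, the resistance distance is $r_G(s,t)=(e_s-e_t)^{T}L^{\dagger}(e_s-e_t)$, where $L^\dagger$ is the Moore–Penrose pseudo-inverse, and the condition number is $\kappa(G)=2/\mu_2$, where $\mu_2$ is the smallest non-zero eigenvalue of the normalized Laplacian $I-D^{-1/2}AD^{-1/2}$. In the adjacency-list model a graph on the vertex set $\{0,\dots,n-1\}$ is given by an arbitrarily ordered list of neighbours for each vertex and is accessible only through degree queries (return $d_v$), neighbour queries (return the $i$-th neighbour of $v$, or report that there is none) and jump queries (return a uniformly random vertex). Approximating $r_G(s,t)$ in this model with absolute error $\epsilon\le 0.01$ and success probability at least $0.6$ requires $\Omega(\kappa)$ queries. Precisely: there are constants $c>0$ and $K_0$ such that for every $K\ge K_0$ there are an $n$, two distinct vertices $s,t$ and a connected $n$-vertex graph $G$ (with ordered adjacency lists) with $cK\le\kappa(G)\le K$ for which the following holds. Let $0<\epsilon\le 0.01$ and let $\mathcal{A}$ be any randomized query algorithm (which may depend on $n,s,t,\epsilon,K$) that, on every connected graph $H$ on the same vertex set with $\kappa(H)\le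 K$ and for every ordering of its adjacency lists, outputs with probability at least $0.6$ a number $\hat r$ with $|\hat r-r_H(s,t)|\le\epsilon$. Then the expected number of queries that $\mathcal{A}$ makes on $G$ is at least $cK\ge c\,\kappa(G)$; in particular its worst-case number of queries on $G$ is at least $c\,\kappa(G)$. -/

import Mathlib

open MeasureTheory
open scoped ENNReal Matrix

/-! ## Graphs given by adjacency lists, resistance distance, condition number -/

/-- A simple undirected unweighted graph on the vertex set `Fin n`, presented by adjacency lists:
`nbrs v` lists the neighbours of `v`, without repetition, in an arbitrary order. -/
structure AdjList (n : ℕ) where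
  nbrs : Fin n → List (Fin n)
  nodup : ∀ v, (nbrs v).Nodup
  irrefl : ∀ v, v ∉ nbrs v
  symm : ∀ u v, v ∈ nbrs u → u ∈ nbrs v

namespace AdjList

variable {n : ℕ}

/-- The underlying simple graph. -/
def graph (G : AdjList n) : SimpleGraph (Fin n) where
  Adj u v := v ∈ G.nbrs u
  symm := ⟨fun u v h => G.symm u v h⟩
  loopless := ⟨fun v h => G.irrefl v h⟩

instance (G : AdjList n) : DecidableRel G.graph.Adj :=
  fun u v => inferInstanceAs (Decidable (v ∈ G.nbrs u))

/-- The Laplacian matrix `L = D - A`. -/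
def lap (G : AdjList n) : Matrix (Fin n) (Fin n) ℝ := G.graph.lapMatrix ℝ

theorem lap_isHermitian (G : AdjList n) : G.lap.IsHermitian :=
  G.graph.isHermitian_lapMatrix ℝ

/-- The pseudo-inverse `L† = ∑ (1/λᵢ) uᵢ uᵢᵀ`, the sum running over the nonzero eigenvalues
of `L` (the terms with `λᵢ = 0` vanish because `0⁻¹ = 0`). -/
noncomputable def lapPinv (G : AdjList n) : Matrix (Fin n) (Fin n) ℝ :=
  ∑ i, (G.lap_isHermitian.eigenvalues i)⁻¹ •
    Matrix.vecMulVec (G.lap_isHermitian.eigenvectorBasis i) (G.lap_isHermitian.eigenvectorBasis i)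

/-- The resistance distance `r(s,t) = (eₛ - eₜ)ᵀ L† (eₛ - eₜ)`. -/
noncomputable def resistance (G : AdjList n) (s t : Fin n) : ℝ :=
  (Pi.single s 1 - Pi.single t 1) ⬝ᵥ (G.lapPinv *ᵥ (Pi.single s 1 - Pi.single t 1))

/-- The normalized Laplacian `I - D^{-1/2} A D^{-1/2}`. -/
noncomputable def normLap (G : AdjList n) : Matrix (Fin n) (Fin n) ℝ :=
  1 - Matrix.diagonal (fun v => (√(G.graph.degree v : ℝ))⁻¹) * G.graph.adjMatrix ℝ *
    Matrix.diagonal (fun v => (√(G.graph.degree v : ℝ))⁻¹)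

/-- The condition number `κ = 2 / μ₂`, with `μ₂` the smallest nonzero eigenvalue of the
normalized Laplacian (the spectrum is a finite set of nonnegative reals, so that the infimum is a
minimum whenever the graph has an edge). -/
noncomputable def kappa (G : AdjList n) : ℝ :=
  2 / sInf {μ : ℝ | μ ∈ spectrum ℝ G.normLap ∧ μ ≠ 0}

end AdjList

/-! ## The adjacency-list query model -/

/-- The three types of queries. -/
inductive Query (n : ℕ) where
  /-- ask for the degree of `v` -/
  | degree (v : Fin n)
  /-- ask for the `i`-th entry (counted from `0`) of the adjacency list of `v` -/
  | neighbor (v : Fin n) (i : ℕ)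
  /-- ask for a uniformly random vertex -/
  | jump

/-- Answers to queries. -/
inductive Answer (n : ℕ) where
  | number (d : ℕ)
  | vertex (v : Fin n)
  /-- the answer to a neighbour query beyond the end of the list -/
  | nothing

instance (n : ℕ) : MeasurableSpace (Query n) := ⊤

/-- The answer of the oracle for `G`; `j` is the random vertex to be returned if the query is a
jump query. -/
def AdjList.answer {n : ℕ} (G : AdjList n) (j : Fin n) : Query n → Answer n
  | .degree v => .number (G.nbrs v).length
  | .neighbor v i => ((G.nbrs v)[i]?).elim .nothing .vertex
  | .jump => .vertex j

/-- A deterministic query algorithm: from the answers received so far (in order) it determines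
either the next query or the real number that it outputs when it stops. -/
abbrev DetAlg (n : ℕ) : Type := List (Answer n) → Query n ⊕ ℝ

namespace DetAlg

variable {n : ℕ}

/-- The answers that `D` has received after `k` steps on `G`, where `J k` is the random vertex
drawn at step `k`. Once `D` has stopped, the transcript does not change any more. -/
def transcript (D : DetAlg n) (G : AdjList n) (J : ℕ → Fin n) : ℕ → List (Answer n)
  | 0 => []
  | k + 1 =>
    match D (transcript D G J k) with
    | .inl q => transcript D G J k ++ [G.answer (J k) q]
    | .inr _ => transcript D G J k

/-- `D` stops on `G` and outputs `r`. -/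
def Outputs (D : DetAlg n) (G : AdjList n) (J : ℕ → Fin n) (r : ℝ) : Prop :=
  ∃ k, D (D.transcript G J k) = .inr r

/-- The total number of queries (infinite if `D` does not stop). -/
noncomputable def numQueries (D : DetAlg n) (G : AdjList n) (J : ℕ → Fin n) : ℝ≥0∞ :=
  ⨆ k, ((D.transcript G J k).length : ℝ≥0∞)

end DetAlg

/-- A randomized query algorithm on graphs with vertex set `Fin n`: a deterministic algorithm
that depends measurably on the outcome `ω` of its internal coins, which live on an arbitrary
probability space. -/
structure RandAlg (n : ℕ) where
  Ω : Type
  [mΩ : MeasurableSpace Ω]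
  μ : Measure Ω
  [isProb : IsProbabilityMeasure μ]
  alg : Ω → DetAlg n
  measurable_alg : ∀ h : List (Answer n), Measurable fun ω => alg ω h

attribute [instance] RandAlg.mΩ RandAlg.isProb

namespace RandAlg

variable {n : ℕ} [NeZero n]

/-- The joint law of the internal coins and of the random vertices returned by jump queries, which
are independent, uniformly distributed, and independent of the coins. -/
noncomputable def law (A : RandAlg n) : Measure (A.Ω × (ℕ → Fin n)) :=
  A.μ.prod (Measure.infinitePi fun _ : ℕ => (PMF.uniformOfFintype (Fin n)).toMeasure)

/-- The probability that `A`, run on `G`, stops with an output within `ε` of `r(s,t)`. -/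
noncomputable def successProb (A : RandAlg n) (G : AdjList n) (s t : Fin n) (ε : ℝ) : ℝ≥0∞ :=
  A.law {p | ∃ r : ℝ, (A.alg p.1).Outputs G p.2 r ∧ |r - G.resistance s t| ≤ ε}

/-- The expected number of queries that `A` makes on `G`. -/
noncomputable def expectedQueries (A : RandAlg n) (G : AdjList n) : ℝ≥0∞ :=
  ∫⁻ p, (A.alg p.1).numQueries G p.2 ∂A.law

end RandAlg

/-!
Join two copies of the complete graph on `m + 1` vertices by an edge between two hubs `s` and `t`.
This edge is a bridge, so `r(s, t) = 1`. As it cuts a graph of volume of order `m ^ 2` and diameter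
`3` into halves, the condition number is of order `m ^ 2`. For each of the `m.choose 2` pairs `z` of
non-hub vertices of the clique, exchanging the two edges over `z` for the two edges that join their
endpoints across the copies yields a graph of the same volume, still of diameter at most `3`, in
which a path of length `3` in parallel with the edge `s t` lowers the resistance to at most `3 / 4`.
An algorithm that succeeds on all these graphs must tell them apart from the original one. The
queries that do so for different `z` are disjoint, so that a run with `k` queries excludes at most
`k` of the pairs. Running the algorithm on the original graph and on the graph of `z` with the same
random bits, both outputs are accurate, hence different, with probability at least `2 * p - 1` if
the success probability is `p`. Summing over `z` bounds the expected number of queries from below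
by `(2 * p - 1) * m.choose 2`.
-/

/-! ## Runs of an algorithm on graphs that differ in few answers -/

section Probability

variable {Ω ι : Type*} [MeasurableSpace Ω]

theorem ofReal_two_mul_sub_one_le_measure_inter (μ : Measure Ω) [IsProbabilityMeasure μ]
    {S T : Set Ω} (hT : MeasurableSet T) {p : ℝ} (hSp : ENNReal.ofReal p ≤ μ S)
    (hTp : ENNReal.ofReal p ≤ μ T) : ENNReal.ofReal (2 * p - 1) ≤ μ (S ∩ T) := by
  have hunion : μ.real (S ∪ T) ≤ 1 := measureReal_le_one
  have hadd : μ.real (S ∪ T) + μ.real (S ∩ T) = μ.real S + μ.real T :=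
    measureReal_union_add_inter hT
  rw [ENNReal.ofReal_le_iff_le_toReal (measure_ne_top _ _)] at hSp hTp ⊢
  simp only [← measureReal_def] at hSp hTp ⊢
  linarith

theorem sum_measure_eq_lintegral_card [Fintype ι] (μ : Measure Ω) {S : ι → Set Ω}
    [∀ ω, DecidablePred fun i => ω ∈ S i] (hS : ∀ i, MeasurableSet (S i)) :
    ∑ i, μ (S i) = ∫⁻ ω, (Finset.univ.filter fun i => ω ∈ S i).card ∂μ := by
  classical
  simp only [← lintegral_indicator_one (hS _)]
  rw [← lintegral_finsetSum _ fun i _ => measurable_one.indicator (hS i)]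
  simp only [Set.indicator_apply, Pi.one_apply, Finset.sum_boole]

end Probability

/-- The queries that `G` and `H` can answer differently. -/
def AdjList.distinguishing {n : ℕ} (G H : AdjList n) : Set (Query n) :=
  {q | ∃ j, G.answer j q ≠ H.answer j q}

namespace DetAlg

variable {n : ℕ}

/-- The transcript that follows `h` when the algorithm decides `a` and the drawn vertex is `j`. -/
def extend (G : AdjList n) (h : List (Answer n)) (j : Fin n) (a : Query n ⊕ ℝ) : List (Answer n) :=
  a.elim (fun q => h ++ [G.answer j q]) fun _ => h

variable {D : DetAlg n} {G : AdjList n} {J : ℕ → Fin n}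

theorem transcript_succ (k : ℕ) : D.transcript G J (k + 1) =
    extend G (D.transcript G J k) (J k) (D (D.transcript G J k)) := by
  rw [transcript]
  cases D (D.transcript G J k) <;> rfl

theorem Outputs.eventually {r : ℝ} (h : D.Outputs G J r) :
    ∀ᶠ k in Filter.atTop, D (D.transcript G J k) = .inr r := by
  obtain ⟨k, hk⟩ := h
  refine Filter.eventually_atTop.2 ⟨k, fun j hj => ?_⟩
  induction j, hj using Nat.le_induction with
  | base => exact hk
  | succ j _ ih => simp only [transcript_succ, ih, extend, Sum.elim_inr]

variable {ι : Type*} {H : ι → AdjList n}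

open Classical in
theorem card_distinguished_le_one
    (hH : Pairwise (Function.onFun Disjoint fun i => G.distinguishing (H i))) (I : Finset ι)
    (q : Query n) (j : Fin n) :
    (I.filter fun i => G.answer j q ≠ (H i).answer j q).card ≤ 1 := by
  refine Finset.card_le_one.2 fun i hi i' hi' => ?_
  by_contra hne
  exact Set.disjoint_left.1 (hH hne) ⟨j, (Finset.mem_filter.1 hi).2⟩
    ⟨j, (Finset.mem_filter.1 hi').2⟩

open Classical in
theorem card_transcript_ne_le_length (D : DetAlg n) (J : ℕ → Fin n)
    (hH : Pairwise (Function.onFun Disjoint fun i => G.distinguishing (H i))) (I : Finset ι)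
    (k : ℕ) :
    (I.filter fun i => D.transcript G J k ≠ D.transcript (H i) J k).card ≤
      (D.transcript G J k).length := by
  induction k with
  | zero => simp only [transcript, ne_eq, not_true_eq_false, Finset.filter_false,
      Finset.card_empty, List.length_nil, le_refl]
  | succ k ih =>
    rcases hq : D (D.transcript G J k) with q | r
    · calc _ ≤ ((I.filter fun i => D.transcript G J k ≠ D.transcript (H i) J k) ∪
              I.filter fun i => G.answer (J k) q ≠ (H i).answer (J k) q).card := by
            refine Finset.card_le_card fun i => ?_
            simp only [Finset.mem_union, Finset.mem_filter, ← and_or_left]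
            refine And.imp_right ?_
            contrapose!
            rintro ⟨htranscript, hanswer⟩
            simp only [transcript_succ, ← htranscript, hq, extend, Sum.elim_inl, hanswer]
        _ ≤ (D.transcript G J k).length + 1 :=
            (Finset.card_union_le _ _).trans
              (Nat.add_le_add ih (card_distinguished_le_one hH I q (J k)))
        _ = _ := by simp only [transcript_succ, hq, extend, Sum.elim_inl, List.length_append,
              List.length_singleton]
    · simp only [transcript_succ, hq, extend, Sum.elim_inr]
      refine (Finset.card_le_card fun i => ?_).trans ih
      simp only [Finset.mem_filter]
      refine And.imp_right ?_
      contrapose!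
      intro htranscript
      simp only [← htranscript, hq, Sum.elim_inr]

theorem card_le_numQueries
    (hH : Pairwise (Function.onFun Disjoint fun i => G.distinguishing (H i))) {I : Finset ι}
    (hI : ∀ i ∈ I, ∃ r r', D.Outputs G J r ∧ D.Outputs (H i) J r' ∧ r ≠ r') :
    (I.card : ℝ≥0∞) ≤ D.numQueries G J := by
  classical
  have hev : ∀ᶠ k in Filter.atTop, ∀ i ∈ I, D.transcript G J k ≠ D.transcript (H i) J k := by
    rw [Filter.eventually_all_finset]
    intro i hi
    obtain ⟨r, r', h, h', hne⟩ := hI i hi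
    filter_upwards [h.eventually, h'.eventually] with k hk hk' heq
    exact hne (Sum.inr_injective (by rw [← hk, ← hk', heq]))
  obtain ⟨k, hk⟩ := hev.exists
  calc (I.card : ℝ≥0∞) ≤ (D.transcript G J k).length := by
        exact_mod_cast (Finset.card_le_card fun i hi =>
          Finset.mem_filter.2 ⟨hi, hk i hi⟩).trans (card_transcript_ne_le_length D J hH I k)
    _ ≤ D.numQueries G J := le_iSup (fun k => ((D.transcript G J k).length : ℝ≥0∞)) k

end DetAlg

instance (n : ℕ) : Countable (Answer n) :=
  Function.Surjective.countable (f := fun a : ℕ ⊕ Option (Fin n) =>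
    a.elim Answer.number fun v => v.elim .nothing .vertex) fun
    | .number d => ⟨.inl d, rfl⟩
    | .vertex v => ⟨.inr (some v), rfl⟩
    | .nothing => ⟨.inr none, rfl⟩

instance (n : ℕ) : MeasurableSpace (List (Answer n)) := ⊤

namespace RandAlg

variable {n : ℕ} (A : RandAlg n) (G : AdjList n)

instance [NeZero n] : IsProbabilityMeasure A.law := by
  unfold law
  infer_instance

theorem measurable_decision {X : A.Ω × (ℕ → Fin n) → List (Answer n)} (hX : Measurable X) :
    Measurable fun p => A.alg p.1 (X p) :=
  (measurable_from_prod_countable_left (f := fun x : A.Ω × List (Answer n) => A.alg x.1 x.2)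
    A.measurable_alg).comp (measurable_fst.prodMk hX)

theorem measurable_extend : Measurable fun x : List (Answer n) × Fin n × (Query n ⊕ ℝ) =>
    DetAlg.extend G x.1 x.2.1 x.2.2 :=
  measurable_from_prod_countable_right fun _ => measurable_from_prod_countable_right fun _ =>
    measurable_fun_sum measurable_from_top measurable_const

theorem measurable_transcript (k : ℕ) : Measurable fun p : A.Ω × (ℕ → Fin n) =>
    (A.alg p.1).transcript G p.2 k := by
  induction k with
  | zero => exact measurable_const
  | succ k ih =>
    simp only [DetAlg.transcript_succ]
    exact (measurable_extend G).comp
      (ih.prodMk (((measurable_pi_apply k).comp measurable_snd).prodMk (A.measurable_decision ih)))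

theorem measurableSet_outputs_mem {S : Set ℝ} (hS : MeasurableSet S) :
    MeasurableSet {p : A.Ω × (ℕ → Fin n) | ∃ r, (A.alg p.1).Outputs G p.2 r ∧ r ∈ S} := by
  have hunion : {p : A.Ω × (ℕ → Fin n) | ∃ r, (A.alg p.1).Outputs G p.2 r ∧ r ∈ S} =
      ⋃ k, (fun p => A.alg p.1 ((A.alg p.1).transcript G p.2 k)) ⁻¹' (Sum.inr '' S) := by
    ext p
    simp only [DetAlg.Outputs, Set.mem_ofPred_eq, Set.mem_iUnion, Set.mem_preimage, Set.mem_image]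
    grind
  rw [hunion]
  exact .iUnion fun k =>
    A.measurable_decision (A.measurable_transcript G k) (MeasurableSet.inr_image hS)

variable {G}

theorem ofReal_mul_card_le_expectedQueries [NeZero n] {ι : Type*} [Fintype ι] {H : ι → AdjList n}
    {s t : Fin n} {ε p : ℝ}
    (hH : Pairwise (Function.onFun Disjoint fun i => G.distinguishing (H i)))
    (hr : ∀ i, 2 * ε < |G.resistance s t - (H i).resistance s t|)
    (hGp : ENNReal.ofReal p ≤ A.successProb G s t ε)
    (hHp : ∀ i, ENNReal.ofReal p ≤ A.successProb (H i) s t ε) :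
    ENNReal.ofReal ((2 * p - 1) * Fintype.card ι) ≤ A.expectedQueries G := by
  classical
  let S (F : AdjList n) : Set (A.Ω × (ℕ → Fin n)) :=
    {ω | ∃ r : ℝ, (A.alg ω.1).Outputs F ω.2 r ∧ |r - F.resistance s t| ≤ ε}
  have hS (F) : MeasurableSet (S F) :=
    A.measurableSet_outputs_mem F (S := {r | |r - F.resistance s t| ≤ ε})
      (measurableSet_le (by fun_prop) (by fun_prop))
  have hcard (ω) : ((Finset.univ.filter fun i => ω ∈ S G ∩ S (H i)).card : ℝ≥0∞) ≤
      (A.alg ω.1).numQueries G ω.2 := by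
    refine DetAlg.card_le_numQueries hH fun i hi => ?_
    obtain ⟨⟨r, hout, hrG⟩, r', hout', hrH⟩ := (Finset.mem_filter_univ i).1 hi
    refine ⟨r, r', hout, hout', ?_⟩
    rintro rfl
    have := abs_sub_le (G.resistance s t) r ((H i).resistance s t)
    rw [abs_sub_comm _ r] at this
    linarith [hr i]
  calc ENNReal.ofReal ((2 * p - 1) * Fintype.card ι)
      = ∑ _i : ι, ENNReal.ofReal (2 * p - 1) := by
        rw [Finset.sum_const, Finset.card_univ, nsmul_eq_mul, mul_comm,
          ENNReal.ofReal_mul (Nat.cast_nonneg _), ENNReal.ofReal_natCast]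
    _ ≤ ∑ i, A.law (S G ∩ S (H i)) := Finset.sum_le_sum fun i _ =>
        ofReal_two_mul_sub_one_le_measure_inter _ (hS _) hGp (hHp i)
    _ = ∫⁻ ω, (Finset.univ.filter fun i => ω ∈ S G ∩ S (H i)).card ∂A.law :=
        sum_measure_eq_lintegral_card _ fun i => (hS G).inter (hS (H i))
    _ ≤ A.expectedQueries G := lintegral_mono hcard

end RandAlg

/-! ## Spectral calculus of real symmetric matrices -/

section Spectral

variable {m : Type*} [Fintype m]

theorem dotProduct_sum_smul_vecMulVec_mulVec (c : m → ℝ) (u : m → m → ℝ) (x : m → ℝ) :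
    x ⬝ᵥ ((∑ i, c i • Matrix.vecMulVec (u i) (u i)) *ᵥ x) = ∑ i, c i * (u i ⬝ᵥ x) ^ 2 := by
  rw [Matrix.sum_mulVec, dotProduct_sum]
  refine Finset.sum_congr rfl fun i _ => ?_
  rw [Matrix.smul_mulVec, Matrix.vecMulVec_mulVec, dotProduct_smul, op_smul_eq_smul,
    dotProduct_smul, dotProduct_comm x, smul_eq_mul, smul_eq_mul, sq]

variable [DecidableEq m] {A : Matrix m m ℝ} (hA : A.IsHermitian)

theorem sum_smul_vecMulVec_eigenvectorBasis (c : m → ℝ) :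
    ∑ i, c i • Matrix.vecMulVec ⇑(hA.eigenvectorBasis i) ⇑(hA.eigenvectorBasis i) =
      Unitary.conjStarAlgAut ℝ _ hA.eigenvectorUnitary (Matrix.diagonal c) := by
  ext j k
  rw [Unitary.conjStarAlgAut_apply, Matrix.mul_apply, Matrix.sum_apply]
  refine Finset.sum_congr rfl fun i _ => ?_
  simp only [Matrix.smul_apply, Matrix.vecMulVec_apply, Matrix.mul_diagonal, Matrix.star_apply,
    Matrix.IsHermitian.eigenvectorUnitary_apply, star_trivial, smul_eq_mul]
  ring

theorem dotProduct_mulVec_self_eq_sum (x : m → ℝ) :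
    x ⬝ᵥ (A *ᵥ x) = ∑ i, hA.eigenvalues i * (⇑(hA.eigenvectorBasis i) ⬝ᵥ x) ^ 2 := by
  have hsum : A = ∑ i, hA.eigenvalues i •
      Matrix.vecMulVec ⇑(hA.eigenvectorBasis i) ⇑(hA.eigenvectorBasis i) :=
    hA.spectral_theorem.trans (sum_smul_vecMulVec_eigenvectorBasis hA _).symm
  conv_lhs => rw [hsum]
  exact dotProduct_sum_smul_vecMulVec_mulVec _ _ x

theorem dotProduct_self_eq_sum (x : m → ℝ) :
    x ⬝ᵥ x = ∑ i, (⇑(hA.eigenvectorBasis i) ⬝ᵥ x) ^ 2 := by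
  have hsum : (1 : Matrix m m ℝ) = ∑ i, (1 : ℝ) •
      Matrix.vecMulVec ⇑(hA.eigenvectorBasis i) ⇑(hA.eigenvectorBasis i) := by
    rw [sum_smul_vecMulVec_eigenvectorBasis, Matrix.diagonal_one, map_one]
  simpa only [← hsum, Matrix.one_mulVec, one_mul] using
    dotProduct_sum_smul_vecMulVec_mulVec (fun _ => 1) (fun i => ⇑(hA.eigenvectorBasis i)) x

include hA in
theorem exists_mem_spectrum_ne_zero_mul_dotProduct_le {x : m → ℝ} (hx : x ≠ 0)
    (hker : ∀ y, A *ᵥ y = 0 → y ⬝ᵥ x = 0) :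
    ∃ μ ∈ spectrum ℝ A, μ ≠ 0 ∧ μ * (x ⬝ᵥ x) ≤ x ⬝ᵥ (A *ᵥ x) := by
  set c : m → ℝ := fun i => ⇑(hA.eigenvectorBasis i) ⬝ᵥ x
  have hsum (w : m → ℝ) : ∑ i with c i ≠ 0, w i * c i ^ 2 = ∑ i, w i * c i ^ 2 :=
    Finset.sum_filter_of_ne fun i _ h hc => h (by rw [hc]; ring)
  have hsupport : (Finset.univ.filter fun i => c i ≠ 0).Nonempty := by
    rw [Finset.nonempty_iff_ne_empty]
    intro h
    refine hx (dotProduct_self_eq_zero.1 ?_)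
    have hzero := hsum 1
    rw [h, Finset.sum_empty] at hzero
    simpa only [dotProduct_self_eq_sum hA, Pi.one_apply, one_mul] using hzero.symm
  have haverage : ∑ i with c i ≠ 0, hA.eigenvalues i * (x ⬝ᵥ x) * c i ^ 2 ≤
      ∑ i with c i ≠ 0, x ⬝ᵥ (A *ᵥ x) * c i ^ 2 := by
    rw [hsum fun i => hA.eigenvalues i * (x ⬝ᵥ x), hsum fun _ => x ⬝ᵥ (A *ᵥ x), ← Finset.mul_sum,
      ← dotProduct_self_eq_sum hA, dotProduct_mulVec_self_eq_sum hA, Finset.sum_mul]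
    exact (Finset.sum_congr rfl fun i _ => by ring).le
  obtain ⟨i, hi, hle⟩ := Finset.exists_le_of_sum_le hsupport haverage
  have hci : c i ≠ 0 := (Finset.mem_filter_univ i).1 hi
  refine ⟨hA.eigenvalues i, hA.eigenvalues_mem_spectrum_real i, fun h => hci (hker _ ?_),
    le_of_mul_le_mul_right hle (by positivity)⟩
  rw [hA.mulVec_eigenvectorBasis, h, zero_smul]

end Spectral

/-! ## Dirichlet energy -/

section Energy

variable {V : Type*}

/-- The squared difference of `f` along an unordered pair of vertices. -/
def sqDiff (f : V → ℝ) : Sym2 V → ℝ :=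
  Sym2.lift ⟨fun u v => (f u - f v) ^ 2, fun u v => sub_sq_comm (f u) (f v)⟩

theorem sqDiff_mk (f : V → ℝ) (u v : V) : sqDiff f s(u, v) = (f u - f v) ^ 2 := rfl

theorem sqDiff_nonneg (f : V → ℝ) (e : Sym2 V) : 0 ≤ sqDiff f e := by
  induction e with | _ u v => exact sq_nonneg _

/-- The Dirichlet energy of `f`, the power dissipated by the electrical potential `f` when every
edge has unit resistance. -/
def dirichletEnergy (G : SimpleGraph V) [Fintype G.edgeSet] (f : V → ℝ) : ℝ :=
  ∑ e ∈ G.edgeFinset, sqDiff f e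

section Sum

variable [Fintype V] {G : SimpleGraph V} [DecidableRel G.Adj]

theorem sum_sum_adj_eq_two_mul_sum_edgeFinset (F : Sym2 V → ℝ) :
    ∑ u, ∑ v, (if G.Adj u v then F s(u, v) else 0) = 2 * ∑ e ∈ G.edgeFinset, F e := by
  classical
  calc ∑ u, ∑ v, (if G.Adj u v then F s(u, v) else 0)
      = ∑ x : V × V with G.Adj x.1 x.2, F s(x.1, x.2) := by
        rw [Finset.sum_filter, Fintype.sum_prod_type]
    _ = ∑ d : G.Dart, F d.edge :=
        (Finset.sum_bij' (fun d _ => d.toProd) (fun x hx => ⟨x, (Finset.mem_filter_univ x).1 hx⟩)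
          (fun d _ => (Finset.mem_filter_univ _).2 d.adj) (fun _ _ => Finset.mem_univ _)
          (fun _ _ => rfl) (fun _ _ => rfl) fun _ _ => rfl).symm
    _ = ∑ e ∈ G.edgeFinset, ∑ d : G.Dart with d.edge = e, F e := by
        rw [← Finset.sum_fiberwise_of_maps_to fun d _ => SimpleGraph.mem_edgeFinset.2 d.edge_mem]
        exact Finset.sum_congr rfl fun e _ => Finset.sum_congr rfl fun d hd => by
          rw [(Finset.mem_filter_univ d).1 hd]
    _ = 2 * ∑ e ∈ G.edgeFinset, F e := by
        rw [Finset.mul_sum]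
        refine Finset.sum_congr rfl fun e he => ?_
        rw [Finset.sum_const, G.dart_edge_fiber_card e (SimpleGraph.mem_edgeFinset.1 he),
          nsmul_eq_mul, Nat.cast_ofNat]

theorem dotProduct_lapMatrix_mulVec [DecidableEq V] (f : V → ℝ) :
    f ⬝ᵥ (G.lapMatrix ℝ *ᵥ f) = dirichletEnergy G f := by
  rw [← Matrix.toLinearMap₂'_apply', SimpleGraph.lapMatrix_toLinearMap₂']
  simp only [← sqDiff_mk]
  rw [sum_sum_adj_eq_two_mul_sum_edgeFinset, dirichletEnergy, mul_div_cancel_left₀ _ two_ne_zero]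

end Sum

variable {G : SimpleGraph V} {u v : V} (f : V → ℝ)

theorem sq_sub_le_length_mul_sum_edges (p : G.Walk u v) :
    (f u - f v) ^ 2 ≤ p.length * (p.edges.map (sqDiff f)).sum := by
  induction p with
  | nil => simp only [sub_self, SimpleGraph.Walk.length_nil, Nat.cast_zero, zero_mul, ne_eq,
      OfNat.ofNat_ne_zero, not_false_eq_true, zero_pow, le_refl]
  | @cons u w v h p ih =>
    simp only [SimpleGraph.Walk.length_cons, SimpleGraph.Walk.edges_cons, List.map_cons,
      List.sum_cons, sqDiff_mk, Nat.cast_add, Nat.cast_one]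
    set S := (p.edges.map (sqDiff f)).sum
    have hS : 0 ≤ S := List.sum_nonneg fun x hx => by
      obtain ⟨e, _, rfl⟩ := List.mem_map.1 hx
      exact sqDiff_nonneg f e
    have hcross : 2 * ((f u - f w) * (f w - f v)) ≤ p.length * (f u - f w) ^ 2 + S :=
      two_mul_le_add_of_sq_le_mul (by positivity) hS (by
        rw [mul_pow]
        nlinarith [mul_le_mul_of_nonneg_left ih (sq_nonneg (f u - f w))])
    linarith

variable [Fintype G.edgeSet]

theorem dirichletEnergy_nonneg : 0 ≤ dirichletEnergy G f :=
  Finset.sum_nonneg fun e _ => sqDiff_nonneg f e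

theorem sum_edges_le_dirichletEnergy {p : G.Walk u v} (hp : p.IsTrail) :
    (p.edges.map (sqDiff f)).sum ≤ dirichletEnergy G f := by
  classical
  rw [← List.sum_toFinset _ hp.edges_nodup]
  refine Finset.sum_le_sum_of_subset_of_nonneg (fun e he => ?_) fun e _ _ => sqDiff_nonneg f e
  exact SimpleGraph.mem_edgeFinset.2 (p.edges_subset_edgeSet (List.mem_toFinset.1 he))

theorem sq_sub_le_dist_mul_dirichletEnergy (hG : G.Connected) (u v : V) :
    (f u - f v) ^ 2 ≤ G.dist u v * dirichletEnergy G f := by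
  obtain ⟨p, hp, hlen⟩ := hG.exists_path_of_dist u v
  rw [← hlen]
  exact (sq_sub_le_length_mul_sum_edges f p).trans
    (mul_le_mul_of_nonneg_left (sum_edges_le_dirichletEnergy f hp.isTrail) (Nat.cast_nonneg _))

end Energy

/-! ## Resistance distance -/

namespace AdjList

variable {n : ℕ} (G : AdjList n)

theorem exists_lap_eq_diagonal_lapPinv_eq_diagonal_inv :
    ∃ (φ : Matrix (Fin n) (Fin n) ℝ ≃⋆ₐ[ℝ] Matrix (Fin n) (Fin n) ℝ) (d : Fin n → ℝ),
      G.lap = φ (Matrix.diagonal d) ∧ G.lapPinv = φ (Matrix.diagonal fun i => (d i)⁻¹) :=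
  ⟨_, _, G.lap_isHermitian.spectral_theorem, sum_smul_vecMulVec_eigenvectorBasis _ _⟩

theorem lap_mul_lapPinv_mul_lap : G.lap * G.lapPinv * G.lap = G.lap := by
  obtain ⟨φ, d, hlap, hpinv⟩ := G.exists_lap_eq_diagonal_lapPinv_eq_diagonal_inv
  simp only [hlap, hpinv, ← map_mul, Matrix.diagonal_mul_diagonal, mul_inv_mul_cancel]

theorem lapPinv_mul_lap_mul_lapPinv : G.lapPinv * G.lap * G.lapPinv = G.lapPinv := by
  obtain ⟨φ, d, hlap, hpinv⟩ := G.exists_lap_eq_diagonal_lapPinv_eq_diagonal_inv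
  have hinv (i) : (d i)⁻¹ * d i * (d i)⁻¹ = (d i)⁻¹ := by
    simpa only [inv_inv] using mul_inv_mul_cancel (d i)⁻¹
  simp only [hlap, hpinv, ← map_mul, Matrix.diagonal_mul_diagonal, hinv]

theorem lap_isSymm : G.lap.IsSymm := G.graph.isSymm_lapMatrix ℝ

theorem lapPinv_isSymm : G.lapPinv.IsSymm := by
  rw [lapPinv, Matrix.IsSymm, Matrix.transpose_sum]
  simp only [Matrix.transpose_smul, Matrix.transpose_vecMulVec]

variable {G} {s t : Fin n}

theorem resistance_eq_of_lap_mulVec {f : Fin n → ℝ}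
    (hf : G.lap *ᵥ f = Pi.single s 1 - Pi.single t 1) : G.resistance s t = f s - f t := by
  calc G.resistance s t = (G.lap *ᵥ f) ⬝ᵥ (G.lapPinv *ᵥ (G.lap *ᵥ f)) := by rw [resistance, hf]
    _ = f ⬝ᵥ ((G.lap * G.lapPinv * G.lap) *ᵥ f) := by
        rw [← Matrix.mulVec_mulVec, ← Matrix.mulVec_mulVec, Matrix.dotProduct_mulVec f,
          ← Matrix.mulVec_transpose, G.lap_isSymm.eq]
    _ = f s - f t := by
        rw [lap_mul_lapPinv_mul_lap, hf, dotProduct_sub, dotProduct_single_one,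
          dotProduct_single_one]

variable (G s t) in
theorem exists_potential : ∃ f : Fin n → ℝ,
    f s - f t = G.resistance s t ∧ dirichletEnergy G.graph f = G.resistance s t := by
  refine ⟨G.lapPinv *ᵥ (Pi.single s 1 - Pi.single t 1), ?_, ?_⟩
  · rw [resistance, sub_dotProduct, single_one_dotProduct, single_one_dotProduct]
  · rw [← dotProduct_lapMatrix_mulVec, ← lap]
    nth_rw 1 [← G.lapPinv_isSymm.eq]
    rw [Matrix.mulVec_transpose, ← Matrix.dotProduct_mulVec, Matrix.mulVec_mulVec,
      Matrix.mulVec_mulVec, lapPinv_mul_lap_mul_lapPinv, resistance]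

/-- Rayleigh monotonicity: an edge in parallel with a path of length `k` has resistance
`k / (k + 1)`, and further edges only lower it. -/
theorem length_succ_mul_resistance_le {h : G.graph.Adj t s} {p : G.graph.Walk s t}
    (hp : (SimpleGraph.Walk.cons h p).IsTrail) :
    (p.length + 1) * G.resistance s t ≤ p.length := by
  obtain ⟨f, hdrop, henergy⟩ := G.exists_potential s t
  have hpath := sq_sub_le_length_mul_sum_edges f p
  have hcycle := sum_edges_le_dirichletEnergy f hp
  have hnonneg := dirichletEnergy_nonneg (G := G.graph) f
  rw [SimpleGraph.Walk.edges_cons, List.map_cons, List.sum_cons, sqDiff_mk, sub_sq_comm,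
    hdrop, henergy] at hcycle
  rw [hdrop] at hpath
  rw [henergy] at hnonneg
  set r := G.resistance s t
  rcases hnonneg.eq_or_lt with hr | hr
  · simp only [← hr, mul_zero, Nat.cast_nonneg]
  · refine le_of_mul_le_mul_right ?_ hr
    nlinarith [(Nat.cast_nonneg p.length : (0 : ℝ) ≤ p.length)]

end AdjList

/-! ## Condition number -/

theorem two_mul_sum_mul_sq_le {ι : Type*} [Fintype ι] {w f : ι → ℝ} {C : ℝ} (hw : ∀ i, 0 ≤ w i)
    (hf : ∑ i, w i * f i = 0) (hC : ∀ i j, (f i - f j) ^ 2 ≤ C) :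
    2 * ∑ i, w i * f i ^ 2 ≤ C * ∑ i, w i := by
  have hvariance : ∑ i, ∑ j, w i * w j * (f i - f j) ^ 2 =
      (∑ i, w i) * (2 * ∑ i, w i * f i ^ 2) := by
    have hexpand (i j) : w i * w j * (f i - f j) ^ 2 =
        w i * f i ^ 2 * w j - 2 * (w i * f i * (w j * f j)) + w i * (w j * f j ^ 2) := by ring
    simp only [hexpand, Finset.sum_add_distrib, Finset.sum_sub_distrib, ← Finset.mul_sum,
      ← Finset.sum_mul, hf]
    ring
  have hbound : ∑ i, ∑ j, w i * w j * (f i - f j) ^ 2 ≤ (∑ i, w i) * (C * ∑ i, w i) := by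
    calc _ ≤ ∑ i, ∑ j, w i * w j * C := Finset.sum_le_sum fun i _ => Finset.sum_le_sum fun j _ =>
          mul_le_mul_of_nonneg_left (hC i j) (mul_nonneg (hw i) (hw j))
      _ = _ := by
          simp only [← Finset.sum_mul, ← Finset.mul_sum]
          ring
  rcases (Finset.sum_nonneg fun i _ => hw i).eq_or_lt with hzero | hpos
  · have hw0 (i) : w i = 0 :=
      (Finset.sum_eq_zero_iff_of_nonneg fun i _ => hw i).1 hzero.symm i (Finset.mem_univ i)
    simp only [hw0, zero_mul, Finset.sum_const_zero, mul_zero, le_refl]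
  · exact le_of_mul_le_mul_left (hvariance ▸ hbound) hpos

namespace AdjList

variable {n : ℕ} (G : AdjList n)

/-- The volume of a graph, the sum of its degrees. -/
noncomputable def vol : ℝ := ∑ v, (G.graph.degree v : ℝ)

theorem normLap_isHermitian : G.normLap.IsHermitian := by
  refine Matrix.isHermitian_one.sub ?_
  rw [Matrix.IsHermitian, Matrix.conjTranspose_mul, Matrix.conjTranspose_mul,
    (Matrix.isHermitian_diagonal _).eq, (G.graph.isHermitian_adjMatrix (R := ℝ)).eq,
    Matrix.mul_assoc]

/-- The square root of the degree matrix, relating `normLap` to `lap`. -/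
noncomputable def sqrtDegMatrix : Matrix (Fin n) (Fin n) ℝ :=
  Matrix.diagonal fun v => √(G.graph.degree v : ℝ)

theorem sqrtDegMatrix_mulVec_mulVec (f : Fin n → ℝ) :
    G.sqrtDegMatrix *ᵥ G.sqrtDegMatrix *ᵥ f = fun v => G.graph.degree v * f v := by
  ext v
  rw [sqrtDegMatrix, Matrix.mulVec_diagonal, Matrix.mulVec_diagonal, ← mul_assoc,
    Real.mul_self_sqrt (Nat.cast_nonneg _)]

theorem sqrtDegMatrix_mulVec_dotProduct (f g : Fin n → ℝ) :
    (G.sqrtDegMatrix *ᵥ f) ⬝ᵥ g = f ⬝ᵥ (G.sqrtDegMatrix *ᵥ g) := by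
  rw [Matrix.dotProduct_mulVec, ← Matrix.mulVec_transpose, sqrtDegMatrix,
    Matrix.diagonal_transpose]

theorem lap_mulVec_eq_sqrtDegMatrix_mulVec (f : Fin n → ℝ) :
    G.lap *ᵥ f = G.sqrtDegMatrix *ᵥ G.normLap *ᵥ G.sqrtDegMatrix *ᵥ f := by
  have hsq (v) : √(G.graph.degree v : ℝ) * √(G.graph.degree v : ℝ) = G.graph.degree v :=
    Real.mul_self_sqrt (Nat.cast_nonneg _)
  have hsqrt {u v} (h : G.graph.Adj u v) : √(G.graph.degree u : ℝ) ≠ 0 :=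
    Real.sqrt_ne_zero'.2 (Nat.cast_pos.2 (G.graph.degree_pos_iff_exists_adj u |>.2 ⟨v, h⟩))
  rw [Matrix.mulVec_mulVec, Matrix.mulVec_mulVec]
  congr 1
  ext u v
  rw [sqrtDegMatrix, normLap, lap, SimpleGraph.lapMatrix, SimpleGraph.degMatrix]
  simp only [Matrix.mul_diagonal, Matrix.diagonal_mul, Matrix.sub_apply,
    SimpleGraph.adjMatrix_apply, Matrix.one_apply, Matrix.diagonal_apply]
  rcases eq_or_ne u v with rfl | huv
  · simp only [if_true, SimpleGraph.irrefl, if_false, mul_zero, zero_mul, sub_zero, mul_one, hsq]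
  · rw [if_neg huv, if_neg huv]
    split_ifs with h
    · field_simp [hsqrt h, hsqrt h.symm]
      ring
    · ring

variable {G}

theorem bijective_sqrtDegMatrix_mulVec (hd : ∀ v, 0 < G.graph.degree v) :
    Function.Bijective (G.sqrtDegMatrix *ᵥ ·) := by
  have hsqrt (v) : √(G.graph.degree v : ℝ) ≠ 0 := Real.sqrt_ne_zero'.2 (Nat.cast_pos.2 (hd v))
  refine Function.bijective_iff_has_inverse.2
    ⟨fun x v => (√(G.graph.degree v : ℝ))⁻¹ * x v, fun f => ?_, fun x => ?_⟩ <;> ext v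
  · simp only [sqrtDegMatrix, Matrix.mulVec_diagonal, inv_mul_cancel_left₀ (hsqrt v)]
  · simp only [sqrtDegMatrix, Matrix.mulVec_diagonal, mul_inv_cancel_left₀ (hsqrt v)]

theorem exists_lap_mulVec_eq_of_mem_spectrum (hd : ∀ v, 0 < G.graph.degree v) {μ : ℝ}
    (hμ : μ ∈ spectrum ℝ G.normLap) :
    ∃ f ≠ 0, G.lap *ᵥ f = fun v => μ * (G.graph.degree v * f v) := by
  rw [← Matrix.spectrum_toLin', ← Module.End.hasEigenvalue_iff_mem_spectrum] at hμ
  obtain ⟨x, hx⟩ := hμ.exists_hasEigenvector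
  obtain ⟨f, rfl⟩ := (bijective_sqrtDegMatrix_mulVec hd).surjective x
  have heigen : G.normLap *ᵥ G.sqrtDegMatrix *ᵥ f = μ • G.sqrtDegMatrix *ᵥ f := by
    rw [← Matrix.toLin'_apply, hx.apply_eq_smul]
  refine ⟨f, fun hf => hx.2 (by rw [hf]; exact Matrix.mulVec_zero _), ?_⟩
  rw [lap_mulVec_eq_sqrtDegMatrix_mulVec, heigen, Matrix.mulVec_smul, sqrtDegMatrix_mulVec_mulVec]
  rfl

theorem sum_lap_mulVec (f : Fin n → ℝ) : ∑ v, (G.lap *ᵥ f) v = 0 := by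
  rw [← one_dotProduct, Matrix.dotProduct_mulVec, ← Matrix.mulVec_transpose, G.lap_isSymm.eq, lap]
  exact (congrArg (· ⬝ᵥ f) G.graph.lapMatrix_mulVec_const_eq_zero).trans (zero_dotProduct f)

section Connected

variable [Nontrivial (Fin n)] (hG : G.graph.Connected)

include hG

theorem two_mul_sum_degree_mul_sq_le_diam_mul {f : Fin n → ℝ}
    (hf : ∑ v, G.graph.degree v * f v = 0) :
    2 * ∑ v, G.graph.degree v * f v ^ 2 ≤ G.graph.diam * dirichletEnergy G.graph f * G.vol :=
  two_mul_sum_mul_sq_le (fun _ => Nat.cast_nonneg _) hf fun u v =>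
    (sq_sub_le_dist_mul_dirichletEnergy f hG u v).trans <| mul_le_mul_of_nonneg_right
      (Nat.cast_le.2 <| SimpleGraph.dist_le_diam <| SimpleGraph.connected_iff_ediam_ne_top.1 hG)
      (dirichletEnergy_nonneg f)

theorem two_le_diam_mul_vol_mul_of_mem_spectrum {μ : ℝ} (hμ : μ ∈ spectrum ℝ G.normLap)
    (hμ0 : μ ≠ 0) : 2 ≤ G.graph.diam * G.vol * μ := by
  have hd := fun v => hG.preconnected.degree_pos_of_nontrivial v
  obtain ⟨f, hf0, hf⟩ := exists_lap_mulVec_eq_of_mem_spectrum hd hμ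
  have hmean : ∑ v, G.graph.degree v * f v = 0 := by
    have := sum_lap_mulVec (G := G) f
    rw [hf, ← Finset.mul_sum] at this
    exact (mul_eq_zero.1 this).resolve_left hμ0
  have henergy : dirichletEnergy G.graph f = μ * ∑ v, G.graph.degree v * f v ^ 2 := by
    rw [← dotProduct_lapMatrix_mulVec, ← lap, hf, dotProduct, Finset.mul_sum]
    exact Finset.sum_congr rfl fun v _ => by ring
  have hpos : 0 < ∑ v, G.graph.degree v * f v ^ 2 := by
    obtain ⟨v, hv⟩ := Function.ne_iff.1 hf0
    refine Finset.sum_pos' (fun v _ => by positivity) ⟨v, Finset.mem_univ v, ?_⟩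
    have := hd v
    have : f v ≠ 0 := hv
    positivity
  have := two_mul_sum_degree_mul_sq_le_diam_mul hG hmean
  rw [henergy] at this
  nlinarith

theorem pos_of_mem_spectrum_normLap {μ : ℝ} (hμ : μ ∈ spectrum ℝ G.normLap) (hμ0 : μ ≠ 0) :
    0 < μ := by
  have hvol : 0 ≤ G.vol := Finset.sum_nonneg fun v _ => Nat.cast_nonneg _
  by_contra! h
  nlinarith [two_le_diam_mul_vol_mul_of_mem_spectrum hG hμ hμ0,
    mul_nonneg (Nat.cast_nonneg (α := ℝ) G.graph.diam) hvol]

theorem kappa_le_diam_mul_vol : G.kappa ≤ G.graph.diam * G.vol := by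
  have hvol : 0 ≤ G.vol := Finset.sum_nonneg fun v _ => Nat.cast_nonneg _
  rw [kappa]
  rcases Set.eq_empty_or_nonempty {μ : ℝ | μ ∈ spectrum ℝ G.normLap ∧ μ ≠ 0} with hempty | hne
  · rw [hempty, Real.sInf_empty, div_zero]
    positivity
  · obtain ⟨hμ, hμ0⟩ := hne.csInf_mem (G.normLap.finite_real_spectrum.subset fun _ h => h.1)
    exact (div_le_iff₀ (pos_of_mem_spectrum_normLap hG hμ hμ0)).2
      (two_le_diam_mul_vol_mul_of_mem_spectrum hG hμ hμ0)

theorem two_le_kappa_mul_of_mem_spectrum {μ : ℝ} (hμ : μ ∈ spectrum ℝ G.normLap) (hμ0 : μ ≠ 0) :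
    2 ≤ G.kappa * μ := by
  have hmem : μ ∈ {μ : ℝ | μ ∈ spectrum ℝ G.normLap ∧ μ ≠ 0} := ⟨hμ, hμ0⟩
  have hfinite : {μ : ℝ | μ ∈ spectrum ℝ G.normLap ∧ μ ≠ 0}.Finite :=
    G.normLap.finite_real_spectrum.subset fun _ h => h.1
  obtain ⟨hmin, hmin0⟩ := Set.Nonempty.csInf_mem ⟨μ, hmem⟩ hfinite
  rw [kappa, div_mul_eq_mul_div, le_div_iff₀ (pos_of_mem_spectrum_normLap hG hmin hmin0)]
  exact mul_le_mul_of_nonneg_left (csInf_le hfinite.bddBelow hmem) zero_le_two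

theorem two_mul_sum_degree_mul_sq_le_kappa_mul {f : Fin n → ℝ}
    (hf : ∑ v, G.graph.degree v * f v = 0) :
    2 * ∑ v, G.graph.degree v * f v ^ 2 ≤ G.kappa * dirichletEnergy G.graph f := by
  have hd := fun v => hG.preconnected.degree_pos_of_nontrivial v
  rcases eq_or_ne f 0 with rfl | hf0
  · simp only [Pi.zero_apply, ne_eq, OfNat.ofNat_ne_zero, not_false_eq_true, zero_pow, mul_zero,
      Finset.sum_const_zero, ← dotProduct_lapMatrix_mulVec, Matrix.mulVec_zero, dotProduct_zero,
      le_refl]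
  have hx : G.sqrtDegMatrix *ᵥ f ≠ 0 := fun h =>
    hf0 ((bijective_sqrtDegMatrix_mulVec hd).injective (h.trans (Matrix.mulVec_zero _).symm))
  have hker (y) (hy : G.normLap *ᵥ y = 0) : y ⬝ᵥ (G.sqrtDegMatrix *ᵥ f) = 0 := by
    obtain ⟨g, rfl⟩ := (bijective_sqrtDegMatrix_mulVec hd).surjective y
    have hg : G.lap *ᵥ g = 0 := by
      rw [lap_mulVec_eq_sqrtDegMatrix_mulVec, hy, Matrix.mulVec_zero]
    have hconst := G.graph.lapMatrix_mulVec_eq_zero_iff_forall_reachable.1 hg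
    obtain ⟨v₀⟩ := hG.nonempty
    rw [sqrtDegMatrix_mulVec_dotProduct, sqrtDegMatrix_mulVec_mulVec, dotProduct]
    simp only [fun v => hconst v v₀ (hG v v₀), ← Finset.mul_sum, hf, mul_zero]
  obtain ⟨μ, hμ, hμ0, hle⟩ :=
    exists_mem_spectrum_ne_zero_mul_dotProduct_le G.normLap_isHermitian hx hker
  rw [sqrtDegMatrix_mulVec_dotProduct, sqrtDegMatrix_mulVec_mulVec,
    sqrtDegMatrix_mulVec_dotProduct, ← lap_mulVec_eq_sqrtDegMatrix_mulVec, lap,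
    dotProduct_lapMatrix_mulVec] at hle
  have hgap := two_le_kappa_mul_of_mem_spectrum hG hμ hμ0
  have hkappa : 0 ≤ G.kappa := by
    by_contra! h
    nlinarith [pos_of_mem_spectrum_normLap hG hμ hμ0]
  calc 2 * ∑ v, G.graph.degree v * f v ^ 2
      ≤ G.kappa * μ * ∑ v, G.graph.degree v * f v ^ 2 :=
        mul_le_mul_of_nonneg_right hgap (Finset.sum_nonneg fun v _ => by positivity)
    _ = G.kappa * (μ * f ⬝ᵥ fun v => G.graph.degree v * f v) := by
        rw [mul_assoc, dotProduct]
        congr 2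
        exact Finset.sum_congr rfl fun v _ => by ring
    _ ≤ G.kappa * dirichletEnergy G.graph f := mul_le_mul_of_nonneg_left hle hkappa

end Connected

end AdjList

/-! ## Two cliques joined by an edge -/

namespace AdjList

theorem degree_eq_length {n : ℕ} (G : AdjList n) (v : Fin n) :
    G.graph.degree v = (G.nbrs v).length := by
  have hnbrs : G.graph.neighborFinset v = (G.nbrs v).toFinset := by
    ext u
    rw [SimpleGraph.mem_neighborFinset, List.mem_toFinset]
    rfl
  rw [← SimpleGraph.card_neighborFinset_eq_degree, hnbrs,
    List.toFinset_card_of_nodup (G.nodup v)]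

variable {V : Type*} [DecidableEq V]

/-- The edges of the complete graph on `Option V` with a loop at the hub `none` whose lifts to
`crossedCliques` switch sides: the loop, and the edges in `C`. -/
def crossed (C : Finset (Sym2 V)) : Option V → Option V → Bool
  | none, none => true
  | some a, some b => decide (s(a, b) ∈ C)
  | _, _ => false

theorem crossed_comm (C : Finset (Sym2 V)) (a b : Option V) : crossed C a b = crossed C b a := by
  cases a <;> cases b <;> simp only [crossed, Sym2.eq_swap]

theorem crossed_empty (a b : Option V) :
    crossed (∅ : Finset (Sym2 V)) a b = decide (a = none ∧ b = none) := by
  cases a <;> cases b <;> simp [crossed]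

variable [Fintype V] {n : ℕ}

/-- The neighbours of `a` in the complete graph on `Option V` with a loop at the hub `none`, in a
fixed order. -/
noncomputable def cliqueNbrs (a : Option V) : List (Option V) :=
  (Finset.univ.filter fun b => b ≠ a ∨ b = none).toList

theorem mem_cliqueNbrs {a b : Option V} : b ∈ cliqueNbrs a ↔ b ≠ a ∨ b = none := by
  rw [cliqueNbrs, Finset.mem_toList, Finset.mem_filter_univ]

theorem length_cliqueNbrs (a : Option V) :
    (cliqueNbrs a).length = Fintype.card V + if a = none then 1 else 0 := by
  rw [cliqueNbrs, Finset.length_toList]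
  cases a with
  | none =>
    rw [if_pos rfl, Finset.filter_true_of_mem fun b _ => ne_or_eq b none, Finset.card_univ,
      Fintype.card_option]
  | some a =>
    have hfilter : (Finset.univ.filter fun b => b ≠ some a ∨ b = none) =
        Finset.univ.erase (some a) := by
      ext b
      cases b <;> simp
    rw [hfilter, Finset.card_erase_of_mem (Finset.mem_univ _), Finset.card_univ,
      Fintype.card_option, if_neg (Option.some_ne_none a), Nat.add_sub_cancel, Nat.add_zero]

/-- Two copies of the complete graph on `Option V`, joined by an edge between the two hubs `none`,
in which each pair of edges over `s(a, b) ∈ C` is replaced by the pair of edges that join the two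
endpoints across the copies. Crossing changes no degrees, and no list entries other than those over
`C`. -/
noncomputable def crossedCliques (e : Bool × Option V ≃ Fin n) (C : Finset (Sym2 V)) :
    AdjList n where
  nbrs v := (cliqueNbrs (e.symm v).2).map fun b =>
    e (xor (e.symm v).1 (crossed C (e.symm v).2 b), b)
  nodup v := (Finset.nodup_toList _).map fun _ _ h => (Prod.ext_iff.1 (e.injective h)).2
  irrefl v := by
    obtain ⟨⟨x, a⟩, rfl⟩ := e.surjective v
    simp only [List.mem_map, mem_cliqueNbrs, e.symm_apply_apply, e.injective.eq_iff,
      Prod.mk.injEq]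
    rintro ⟨b, hb, hx, rfl⟩
    obtain rfl := hb.resolve_left (not_not.2 rfl)
    exact Bool.not_ne_self x ((Bool.xor_true x).symm.trans hx)
  symm u v := by
    obtain ⟨⟨x, a⟩, rfl⟩ := e.surjective u
    obtain ⟨⟨y, b⟩, rfl⟩ := e.surjective v
    simp only [List.mem_map, mem_cliqueNbrs, e.symm_apply_apply, e.injective.eq_iff,
      Prod.mk.injEq]
    rintro ⟨b, hb, rfl, rfl⟩
    refine ⟨a, by grind, ?_, rfl⟩
    rw [crossed_comm C b a, Bool.xor_assoc, Bool.xor_self, Bool.xor_false]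

variable (e : Bool × Option V ≃ Fin n) (C : Finset (Sym2 V))

theorem crossedCliques_adj {x y : Bool} {a b : Option V} :
    (crossedCliques e C).graph.Adj (e (x, a)) (e (y, b)) ↔
      (b ≠ a ∨ b = none) ∧ y = xor x (crossed C a b) := by
  simp only [graph, crossedCliques, List.mem_map, mem_cliqueNbrs, e.symm_apply_apply,
    e.injective.eq_iff, Prod.mk.injEq]
  constructor
  · rintro ⟨b, hb, rfl, rfl⟩
    exact ⟨hb, rfl⟩
  · rintro ⟨hb, rfl⟩
    exact ⟨b, hb, rfl, rfl⟩

theorem crossedCliques_adj_hubs (x : Bool) :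
    (crossedCliques e C).graph.Adj (e (x, none)) (e (!x, none)) :=
  (crossedCliques_adj e C).2 ⟨.inr rfl, (Bool.xor_true x).symm⟩

theorem crossedCliques_adj_hub (x : Bool) (a : V) :
    (crossedCliques e C).graph.Adj (e (x, none)) (e (x, some a)) :=
  (crossedCliques_adj e C).2 ⟨.inl (Option.some_ne_none a), (Bool.xor_false x).symm⟩

theorem exists_walk_crossedCliques_length_le (u v : Fin n) :
    ∃ p : (crossedCliques e C).graph.Walk u v, p.length ≤ 3 := by
  set Γ := (crossedCliques e C).graph
  have spoke (x a) : ∃ p : Γ.Walk (e (x, none)) (e (x, a)), p.length ≤ 1 := by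
    cases a with
    | none => exact ⟨.nil, Nat.zero_le _⟩
    | some a => exact ⟨(crossedCliques_adj_hub e C x a).toWalk, le_rfl⟩
  have bridge (x y) : ∃ p : Γ.Walk (e (x, none)) (e (y, none)), p.length ≤ 1 := by
    rcases eq_or_ne x y with rfl | hxy
    · exact ⟨.nil, Nat.zero_le _⟩
    · obtain rfl := Bool.eq_not.2 hxy.symm
      exact ⟨(crossedCliques_adj_hubs e C x).toWalk, le_rfl⟩
  obtain ⟨⟨x, a⟩, rfl⟩ := e.surjective u
  obtain ⟨⟨y, b⟩, rfl⟩ := e.surjective v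
  obtain ⟨p, hp⟩ := spoke x a
  obtain ⟨q, hq⟩ := bridge x y
  obtain ⟨r, hr⟩ := spoke y b
  refine ⟨p.reverse.append (q.append r), ?_⟩
  rw [SimpleGraph.Walk.length_append, SimpleGraph.Walk.length_append,
    SimpleGraph.Walk.length_reverse]
  omega

theorem crossedCliques_connected : (crossedCliques e C).graph.Connected where
  preconnected u v := (exists_walk_crossedCliques_length_le e C u v).choose.reachable
  nonempty := ⟨e (false, none)⟩

theorem crossedCliques_diam_le : (crossedCliques e C).graph.diam ≤ 3 := by
  have := (crossedCliques_connected e C).nonempty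
  obtain ⟨u, v, huv⟩ := (crossedCliques e C).graph.exists_dist_eq_diam
  obtain ⟨p, hp⟩ := exists_walk_crossedCliques_length_le e C u v
  exact huv ▸ (SimpleGraph.dist_le p).trans hp

theorem crossedCliques_degree (x : Bool) (a : Option V) :
    (crossedCliques e C).graph.degree (e (x, a)) =
      Fintype.card V + if a = none then 1 else 0 := by
  rw [degree_eq_length, crossedCliques, List.length_map, e.symm_apply_apply, length_cliqueNbrs]

theorem crossedCliques_vol :
    (crossedCliques e C).vol = 2 * ((Fintype.card V : ℝ) ^ 2 + Fintype.card V + 1) := by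
  rw [vol, ← e.sum_comp, Fintype.sum_prod_type]
  simp only [crossedCliques_degree, Fintype.sum_option, if_true, Option.some_ne_none, if_false,
    Finset.sum_const, Finset.card_univ, Fintype.card_bool, nsmul_eq_mul]
  push_cast
  ring

theorem crossedCliques_kappa_le :
    (crossedCliques e C).kappa ≤ 6 * ((Fintype.card V : ℝ) ^ 2 + Fintype.card V + 1) := by
  have := e.symm.nontrivial
  calc (crossedCliques e C).kappa
      ≤ (crossedCliques e C).graph.diam * (crossedCliques e C).vol :=
        kappa_le_diam_mul_vol (crossedCliques_connected e C)
    _ ≤ 3 * (crossedCliques e C).vol :=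
        mul_le_mul_of_nonneg_right (by exact_mod_cast crossedCliques_diam_le e C)
          (Finset.sum_nonneg fun v _ => Nat.cast_nonneg _)
    _ = _ := by
        rw [crossedCliques_vol]
        ring

/-- The potential that is constant on each of the two cliques and drops by `1` along the edge
between them. -/
noncomputable def sidePotential (v : Fin n) : ℝ := if (e.symm v).1 then -(1 / 2) else 1 / 2

omit [DecidableEq V] [Fintype V] in
theorem sidePotential_apply (x : Bool) (a : Option V) :
    sidePotential e (e (x, a)) = if x then -(1 / 2) else 1 / 2 := by
  rw [sidePotential, e.symm_apply_apply]

theorem lap_mulVec_sidePotential :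
    (crossedCliques e ∅).lap *ᵥ sidePotential e =
      Pi.single (e (false, none)) 1 - Pi.single (e (true, none)) 1 := by
  ext v
  obtain ⟨⟨x, a⟩, rfl⟩ := e.surjective v
  have hlap : ((crossedCliques e ∅).lap *ᵥ sidePotential e) (e (x, a)) =
      ∑ u ∈ (crossedCliques e ∅).graph.neighborFinset (e (x, a)),
        (sidePotential e (e (x, a)) - sidePotential e u) := by
    rw [lap, SimpleGraph.lapMatrix_mulVec_apply, Finset.sum_sub_distrib, Finset.sum_const,
      SimpleGraph.card_neighborFinset_eq_degree, nsmul_eq_mul]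
  have hzero (u) (hu : u ∈ (crossedCliques e ∅).graph.neighborFinset (e (x, a)))
      (hne : a = none → u ≠ e (!x, none)) :
      sidePotential e (e (x, a)) - sidePotential e u = 0 := by
    obtain ⟨⟨y, b⟩, rfl⟩ := e.surjective u
    rw [SimpleGraph.mem_neighborFinset, crossedCliques_adj, crossed_empty] at hu
    have : ¬ (a = none ∧ b = none) := by
      rintro ⟨rfl, rfl⟩
      exact hne rfl (by rw [hu.2, decide_eq_true ⟨rfl, rfl⟩, Bool.xor_true])
    rw [sidePotential_apply, sidePotential_apply, hu.2, decide_eq_false this, Bool.xor_false,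
      sub_self]
  rw [hlap]
  cases a with
  | none =>
    rw [Finset.sum_eq_single_of_mem (e (!x, none)) ((SimpleGraph.mem_neighborFinset _ _ _).2
        (crossedCliques_adj_hubs e ∅ x)) fun u hu hne => hzero u hu fun _ => hne,
      sidePotential_apply, sidePotential_apply]
    cases x <;> norm_num [Pi.single_apply]
  | some a =>
    rw [Finset.sum_eq_zero fun u hu => hzero u hu fun h => absurd h (Option.some_ne_none a)]
    simp

theorem crossedCliques_empty_resistance :
    (crossedCliques e ∅).resistance (e (false, none)) (e (true, none)) = 1 := by
  rw [resistance_eq_of_lap_mulVec (lap_mulVec_sidePotential e), sidePotential_apply,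
    sidePotential_apply]
  norm_num

theorem dirichletEnergy_sidePotential :
    dirichletEnergy (crossedCliques e ∅).graph (sidePotential e) = 1 := by
  rw [← dotProduct_lapMatrix_mulVec, ← lap, lap_mulVec_sidePotential, dotProduct_sub,
    dotProduct_single_one, dotProduct_single_one, sidePotential_apply, sidePotential_apply]
  norm_num

theorem le_crossedCliques_empty_kappa :
    (Fintype.card V : ℝ) ^ 2 + Fintype.card V + 1 ≤ (crossedCliques e ∅).kappa := by
  have := e.symm.nontrivial
  have hmean : ∑ v, (crossedCliques e ∅).graph.degree v * sidePotential e v = 0 := by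
    rw [← e.sum_comp, Fintype.sum_prod_type, Fintype.sum_bool, ← Finset.sum_add_distrib]
    refine Finset.sum_eq_zero fun a _ => ?_
    rw [crossedCliques_degree, crossedCliques_degree, sidePotential_apply, sidePotential_apply,
      ← mul_add]
    norm_num
  have hsq (v) : sidePotential e v ^ 2 = 1 / 4 := by
    rw [sidePotential]
    split_ifs <;> norm_num
  have hgap := two_mul_sum_degree_mul_sq_le_kappa_mul (crossedCliques_connected e ∅) hmean
  simp only [hsq, ← Finset.sum_mul, dirichletEnergy_sidePotential] at hgap
  rw [← vol, crossedCliques_vol] at hgap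
  linarith

variable {C} in
theorem crossedCliques_resistance_le {a b : V} (hab : a ≠ b) (hC : s(a, b) ∈ C) :
    (crossedCliques e C).resistance (e (false, none)) (e (true, none)) ≤ 3 / 4 := by
  have hcross : (crossedCliques e C).graph.Adj (e (false, some a)) (e (true, some b)) :=
    (crossedCliques_adj e C).2
      ⟨.inl fun h => hab (Option.some_injective V h).symm, by
        rw [crossed, decide_eq_true hC, Bool.false_xor]⟩
  have h := length_succ_mul_resistance_le
    (h := crossedCliques_adj_hubs e C true)
    (p := .cons (crossedCliques_adj_hub e C false a) <| .cons hcross <|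
      .cons (crossedCliques_adj_hub e C true b).symm .nil)
    (by simp [SimpleGraph.Walk.isTrail_def])
  norm_num at h
  linarith

theorem exists_neighbor_of_mem_distinguishing_crossedCliques {C D : Finset (Sym2 V)} {q : Query n}
    (hq : q ∈ (crossedCliques e C).distinguishing (crossedCliques e D)) :
    ∃ v i, q = .neighbor v i ∧
      ∃ b ∈ (cliqueNbrs (e.symm v).2)[i]?, crossed C (e.symm v).2 b ≠ crossed D (e.symm v).2 b := by
  obtain ⟨j, hj⟩ := hq
  cases q with
  | degree v => simp [answer, crossedCliques] at hj
  | jump => exact absurd rfl hj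
  | neighbor v i =>
    refine ⟨v, i, rfl, ?_⟩
    simp only [answer, crossedCliques, List.getElem?_map] at hj
    cases hb : (cliqueNbrs (e.symm v).2)[i]? with
    | none => simp [hb] at hj
    | some b =>
      refine ⟨b, rfl, fun h => hj ?_⟩
      simp only [hb, Option.map_some, Option.elim_some, h]

theorem disjoint_distinguishing_crossedCliques {y z : Sym2 V} (hyz : y ≠ z) :
    Disjoint ((crossedCliques e ∅).distinguishing (crossedCliques e {y}))
      ((crossedCliques e ∅).distinguishing (crossedCliques e {z})) := by
  have hcrossed {a b : Option V} {z : Sym2 V} (h : crossed ∅ a b ≠ crossed {z} a b) :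
      ∃ a' b', a = some a' ∧ b = some b' ∧ s(a', b') = z := by
    cases a <;> cases b <;> simp_all [crossed]
  refine Set.disjoint_left.2 fun q hy hz => hyz ?_
  obtain ⟨v, i, rfl, b, hb, hcross⟩ := exists_neighbor_of_mem_distinguishing_crossedCliques e hy
  obtain ⟨_, _, hq, b', hb', hcross'⟩ := exists_neighbor_of_mem_distinguishing_crossedCliques e hz
  cases hq
  obtain rfl := Option.mem_unique hb hb'
  obtain ⟨a, b, ha, rfl, rfl⟩ := hcrossed hcross
  obtain ⟨a', b', ha', hbb, rfl⟩ := hcrossed hcross'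
  rw [Option.some_injective V (ha.symm.trans ha'), Option.some_injective V hbb]

end AdjList

/-! ## The lower bound -/

theorem RandAlg.ofReal_mul_choose_two_le_expectedQueries {V : Type*} [DecidableEq V] [Fintype V]
    {n : ℕ} [NeZero n] (A : RandAlg n) (e : Bool × Option V ≃ Fin n) {ε p : ℝ} (hε : ε < 1 / 8)
    (hA : ∀ C, ENNReal.ofReal p ≤
      A.successProb (AdjList.crossedCliques e C) (e (false, none)) (e (true, none)) ε) :
    ENNReal.ofReal ((2 * p - 1) * (Fintype.card V).choose 2) ≤
      A.expectedQueries (AdjList.crossedCliques e ∅) := by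
  rw [← Sym2.card_subtype_not_diag]
  refine A.ofReal_mul_card_le_expectedQueries
    (H := fun z : {z : Sym2 V // ¬ z.IsDiag} => AdjList.crossedCliques e {z.1})
    (fun y z hyz => AdjList.disjoint_distinguishing_crossedCliques e (Subtype.coe_injective.ne hyz))
    ?_ (hA ∅) fun z => hA {z.1}
  rintro ⟨⟨a, b⟩, hab⟩
  have hr := AdjList.crossedCliques_resistance_le e (mt Sym2.mk_isDiag_iff.2 hab)
    (Finset.mem_singleton_self s(a, b))
  rw [AdjList.crossedCliques_empty_resistance]
  exact lt_of_lt_of_le (by linarith) ((sub_le_sub_left hr 1).trans (le_abs_self _))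

theorem exists_nat_six_mul_le_and_div_le_choose_two {K : ℝ} (hK : 54 ≤ K) :
    ∃ m : ℕ, 6 * ((m : ℝ) ^ 2 + m + 1) ≤ K ∧ K / 96 ≤ m.choose 2 := by
  set m := ⌊√(K / 6)⌋₊ - 1
  have hfloor : 3 ≤ ⌊√(K / 6)⌋₊ :=
    Nat.le_floor (Real.le_sqrt_of_sq_le (by norm_num; linarith))
  have hsucc : (m : ℝ) + 1 = ⌊√(K / 6)⌋₊ := by exact_mod_cast Nat.sub_add_cancel (by omega)
  have hm : (2 : ℝ) ≤ m := by exact_mod_cast Nat.le_sub_of_add_le hfloor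
  have hlower : ((m : ℝ) + 1) ^ 2 ≤ K / 6 := by
    rw [hsucc]
    exact (Real.le_sqrt' (by rw [← hsucc]; linarith)).1 (Nat.floor_le (Real.sqrt_nonneg _))
  have hupper : K / 6 < ((m : ℝ) + 1 + 1) ^ 2 := by
    rw [hsucc]
    exact (Real.sqrt_lt' (by rw [← hsucc]; linarith)).1 (Nat.lt_floor_add_one _)
  refine ⟨m, by linarith, ?_⟩
  calc K / 96 ≤ (2 * (m : ℝ)) ^ 2 / 16 := by nlinarith
    _ ≤ m * (m - 1) / 2 := by nlinarith
    _ = m.choose 2 := (Nat.cast_choose_two ℝ m).symm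

theorem theorem7_general {p : ℝ} (hp : 1 / 2 < p) :
    ∃ c : ℝ, 0 < c ∧ ∃ K₀ : ℝ, ∀ K : ℝ, K₀ ≤ K →
      ∃ (n : ℕ) (_ : NeZero n) (G : AdjList n) (s t : Fin n),
        s ≠ t ∧ G.graph.Connected ∧ c * K ≤ G.kappa ∧ G.kappa ≤ K ∧
        ∀ ε : ℝ, ε < 1 / 8 → ∀ A : RandAlg n,
          (∀ H : AdjList n, H.graph.Connected → H.kappa ≤ K →
            ENNReal.ofReal p ≤ A.successProb H s t ε) →
          ENNReal.ofReal (c * K) ≤ A.expectedQueries G := by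
  have hc : 0 < min 1 (2 * p - 1) := lt_min one_pos (by linarith)
  refine ⟨min 1 (2 * p - 1) / 96, by positivity, 54, fun K hK => ?_⟩
  obtain ⟨m, hmK, hKm⟩ := exists_nat_six_mul_le_and_div_le_choose_two hK
  let e := Fintype.equivFin (Bool × Option (Fin m))
  have hconnected (C) := AdjList.crossedCliques_connected e C
  have hkappa (C) := AdjList.crossedCliques_kappa_le e C
  have hle := AdjList.le_crossedCliques_empty_kappa e
  simp only [Fintype.card_fin] at hkappa hle
  have hchoose : (m.choose 2 : ℝ) ≤ m ^ 2 := by exact_mod_cast m.choose_le_pow 2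
  have hcK : min 1 (2 * p - 1) / 96 * K ≤ min 1 (2 * p - 1) * m.choose 2 := by
    rw [div_mul_comm, mul_comm]
    exact mul_le_mul_of_nonneg_left hKm hc.le
  refine ⟨_, inferInstance, AdjList.crossedCliques e ∅, e (false, none), e (true, none),
    e.injective.ne (by simp), hconnected ∅, ?_, (hkappa ∅).trans hmK, fun ε hε A hA => ?_⟩
  · exact (hcK.trans (mul_le_of_le_one_left (Nat.cast_nonneg _) (min_le_left _ _))).trans
      (by linarith)
  · have hA' (C) := hA _ (hconnected C) ((hkappa C).trans hmK)
    have hqueries := A.ofReal_mul_choose_two_le_expectedQueries e hε hA'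
    rw [Fintype.card_fin] at hqueries
    exact (ENNReal.ofReal_le_ofReal (hcK.trans (mul_le_mul_of_nonneg_right (min_le_right _ _)
      (Nat.cast_nonneg _)))).trans hqueries

/-- There are `c > 0` and `K₀` such that for every `K ≥ K₀` there is an instance `(G, s, t)` with
`c K ≤ κ(G) ≤ K` on which every randomized algorithm makes at least `c K ≥ c κ(G)` queries in
expectation (hence also in the worst case over its coins), provided that on every connected graph
with the same vertices and condition number at most `K` it outputs, with probability at least
`0.6`, a value within `ε ≤ 0.01` of `r(s,t)`. The algorithm may depend on `n, s, t, ε, K`. -/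
theorem theorem7 :
    ∃ c : ℝ, 0 < c ∧ ∃ K₀ : ℝ, ∀ K : ℝ, K₀ ≤ K →
      ∃ (n : ℕ) (_ : NeZero n) (G : AdjList n) (s t : Fin n),
        s ≠ t ∧ G.graph.Connected ∧ c * K ≤ G.kappa ∧ G.kappa ≤ K ∧
        ∀ ε : ℝ, 0 < ε → ε ≤ 0.01 → ∀ A : RandAlg n,
          (∀ H : AdjList n, H.graph.Connected → H.kappa ≤ K →
            ENNReal.ofReal 0.6 ≤ A.successProb H s t ε) →
          ENNReal.ofReal (c * K) ≤ A.expectedQueries G := by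
  obtain ⟨c, hc, K₀, h⟩ := theorem7_general (p := 0.6) (by norm_num)
  refine ⟨c, hc, K₀, fun K hK => ?_⟩
  obtain ⟨n, hn, G, s, t, hst, hG, hcK, hκ, hqueries⟩ := h K hK
  exact ⟨n, hn, G, s, t, hst, hG, hcK, hκ, fun ε _ hε => hqueries ε (by linarith)⟩
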